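/- Let $(X_n)_{n\ge 0}$ be a time-homogeneous, irreducible Markov chain with state space $\mathbb N_0=\{0,1,2,\dots\}$ and transition probabilities $(p_{ij})_{i,j\in\mathbb N_0}$. For $i\in\mathbb N_0$ let $\gamma_i:=\sum_{j\in\mathbb N_0}p_{ij}(j-i)\in[-i,\infty]$ be the mean drift at $i$. Suppose that * the chain is downward uniformly bounded, i.e. there exists $k\in\mathbb N$ such that $p_{ij}=0$ whenever $i-j>k$; * $\gamma_i<\infty$ for all $i\ge 0$; * there exists $N\in\mathbb N$ such that $\gamma_i=0$ for all $i\ge N$. Then the chain is null recurrent: for every state $i$, with $T_i:=\inf\{n\ge 1: X_n=i\}$ (and $\inf\emptyset=\infty$), we have $\mathbb P(T_i<\infty\mid X_0=i)=1$ and $\mathbb E(T_i\mid X_0=i)=\infty$. -/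

import Mathlib

open MeasureTheory ProbabilityTheory
open scoped ENNReal

noncomputable section

namespace MarkovChainNat

/- A time-homogeneous Markov chain on the state space `ℕ = {0, 1, 2, …}` is given by its
transition probabilities `p i j`: for every state `i`, the row `p i` is a probability mass
function on `ℕ`. -/

/-- The one-step transition kernel `i ↦ (p i j)_j`. -/
def stepKernel (p : ℕ → PMF ℕ) : Kernel ℕ ℕ :=
  Kernel.ofFunOfCountable fun i => (p i).toMeasure

instance (p : ℕ → PMF ℕ) : IsMarkovKernel (stepKernel p) :=
  ⟨fun i => PMF.toMeasure.isProbabilityMeasure (p i)⟩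

/-- The conditional law of `X (n + 1)` given the past `X 0, …, X n`: it is the row of `p` at the
current state `X n`. -/
def histKernel (p : ℕ → PMF ℕ) (n : ℕ) : Kernel ((_ : Finset.Iic n) → ℕ) ℕ :=
  (stepKernel p).comap (fun h => h ⟨n, Finset.mem_Iic.2 le_rfl⟩) (measurable_pi_apply _)

instance (p : ℕ → PMF ℕ) (n : ℕ) : IsMarkovKernel (histKernel p n) :=
  inferInstanceAs (IsMarkovKernel (Kernel.comap _ _ _))

/-- The law `ℙ(· | X 0 = i)` of the chain started at `i`, a probability measure on the space of
trajectories `ω : ℕ → ℕ` (Ionescu-Tulcea theorem); the chain is the coordinate process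
`X n ω = ω n`. -/
def law (p : ℕ → PMF ℕ) (i : ℕ) : Measure (ℕ → ℕ) :=
  Kernel.traj (X := fun _ => ℕ) (histKernel p) 0 (fun _ => i)

/-- The chain is irreducible: started from any state `i`, it visits any state `j` (at some time
`n ≥ 0`) with positive probability. -/
def IsIrreducible (p : ℕ → PMF ℕ) : Prop :=
  ∀ i j : ℕ, 0 < law p i {ω | ∃ n, ω n = j}

/-- `T i = inf {n ≥ 1 : X n = i}`, with value `⊤ = ∞` if there is no such `n`. -/
def returnTime (i : ℕ) (ω : ℕ → ℕ) : ℕ∞ :=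
  ⨅ n : ℕ, ⨅ _ : 1 ≤ n ∧ ω n = i, (n : ℕ∞)

/-- The state `i` is recurrent: `ℙ(T i < ∞ | X 0 = i) = 1`. -/
def IsRecurrentState (p : ℕ → PMF ℕ) (i : ℕ) : Prop :=
  law p i {ω | returnTime i ω < ⊤} = 1

/-- The state `i` is null recurrent: it is recurrent and `𝔼(T i | X 0 = i) = ∞`. -/
def IsNullRecurrentState (p : ℕ → PMF ℕ) (i : ℕ) : Prop :=
  IsRecurrentState p i ∧ ∫⁻ ω, (returnTime i ω : ℝ≥0∞) ∂(law p i) = ⊤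

/-- The chain is null recurrent: all its states are null recurrent. -/
def IsNullRecurrent (p : ℕ → PMF ℕ) : Prop :=
  ∀ i : ℕ, IsNullRecurrentState p i

/-- The mean drift `γ i = ∑ j, p i j * (j - i)`, an extended real number: the sum of the terms
with `j > i` minus the sum of the absolute values of the terms with `j < i` (the subtractions of
natural numbers below are truncated). The second sum is at most `i`, so that
`-i ≤ γ i ≤ ∞` and the form `∞ - ∞` never occurs. -/
def meanDrift (p : ℕ → PMF ℕ) (i : ℕ) : EReal :=
  ((∑' j : ℕ, p i j * ((j - i : ℕ) : ℝ≥0∞) : ℝ≥0∞) : EReal) -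
    ((∑' j : ℕ, p i j * ((i - j : ℕ) : ℝ≥0∞) : ℝ≥0∞) : EReal)

/-- The chain is downward uniformly bounded: for some `k`, `i - j > k` implies `p i j = 0`. -/
def IsDownwardUniformlyBounded (p : ℕ → PMF ℕ) : Prop :=
  ∃ k : ℕ, ∀ i j : ℕ, (i : ℤ) - (j : ℤ) > (k : ℤ) → p i j = 0

end MarkovChainNat

end

/-!
The proof replaces martingale arguments by inequalities for functions on the state space. For a set
`S` of states let `Q f i = ∑ l ∈ S, p i l * f l` (`tabooOp`). By the Markov property,
`Q^[n] 1 i` is the probability that the chain started at `i` stays in `S` at the times `1, …, n`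
(`law_stays`); with `S = {j}ᶜ` this is `ℙ(T j > n)`. The drift condition says that the identity
function is harmonic at all states `i ≥ N` (`lintegral_id_eq_of_meanDrift_eq_zero`).

*Recurrence.* The limit `h i` of `ℙ(T j > n)` satisfies `h = Q h`, so the function `g` that equals
`h` off `j` and vanishes at `j` is bounded, harmonic off `j` and subharmonic. Let `ε > 0`. As `g`
is bounded, `g i - ε * i` attains its maximum. If the maximum exceeded `max_{l ≤ N} g l`, it would
be attained only at states `i > N`, where the function is subharmonic, so all successors of a maximum
point would be maximum points as well. By irreducibility `j` would be one of them, although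
`g j = 0`. Hence `g i ≤ max_{l ≤ N} g l + ε * i`, and on letting `ε → 0` the function `g` attains
its maximum. Subharmonicity and irreducibility make it constant, so it is zero
(`IsIrreducible.eq_zero_of_harmonic`), and then `h = 0`.

*Nullity.* Let `w i = ∑ n, Q^[n] 1 i` (`exitTime`), the expected time to hit `j`. If `w j` is
finite, irreducibility makes `w` finite everywhere. Let `u x = (x - M)⁺` with `M = max N j`. It is
subharmonic and vanishes at `j`, so `u ≤ Q^[n] u` for all `n`. As the chain moves down by at most
`k` in a step, `u ≤ k * w` (`sub_le_mul_exitTime`). Therefore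
`1 = u (M + 1) ≤ k * (Q^[n] w) (M + 1)`. But `Q^[n] w` is the tail of the series for `w` from
index `n` on and tends to zero, which is absurd (`IsIrreducible.exitTime_eq_top`).
-/

open MeasureTheory ProbabilityTheory
open scoped ENNReal

namespace MarkovChainNat

/-! ### The Markov property and the killed transition operator -/

/-- The transition operator of the chain killed outside `S`:
`(tabooOp p S f) i = ∑ l ∈ S, p i l * f l`. -/
noncomputable def tabooOp (p : ℕ → PMF ℕ) (S : Set ℕ) (f : ℕ → ℝ≥0∞) (i : ℕ) : ℝ≥0∞ :=
  ∫⁻ l in S, f l ∂(p i).toMeasure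

/-- The trajectories that stay in `S` from time `1` to time `n`; time `0` is not constrained. -/
def stays (S : Set ℕ) (n : ℕ) : Set (ℕ → ℕ) :=
  {ω | ∀ m, 1 ≤ m → m ≤ n → ω m ∈ S}

lemma measurableSet_stays (S : Set ℕ) (n : ℕ) : MeasurableSet (stays S n) := by
  have : stays S n = ⋂ m, ⋂ (_ : 1 ≤ m), ⋂ (_ : m ≤ n), (fun ω : ℕ → ℕ => ω m) ⁻¹' S := by
    ext ω; simp [stays]
  rw [this]
  refine MeasurableSet.iInter fun m => MeasurableSet.iInter fun _ => MeasurableSet.iInter fun _ =>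
    measurable_pi_apply m (.of_discrete)

instance (p : ℕ → PMF ℕ) (i : ℕ) : IsProbabilityMeasure (law p i) := by
  unfold law; infer_instance

/-- The Markov property at time `n`, for functionals of product form. -/
lemma lintegral_law_mul_succ (p : ℕ → PMF ℕ) (i n : ℕ)
    {G : ((_ : Finset.Iic n) → ℕ) → ℝ≥0∞} (hG : Measurable G) (f : ℕ → ℝ≥0∞) :
    ∫⁻ ω, G (Preorder.frestrictLe n ω) * f (ω (n + 1)) ∂law p i =
      ∫⁻ ω, G (Preorder.frestrictLe n ω) * ∫⁻ l, f l ∂(p (ω n)).toMeasure ∂law p i := by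
  have hf : Measurable f := .of_discrete
  have hcur : Measurable fun h : (_ : Finset.Iic n) → ℕ => h ⟨n, Finset.mem_Iic.2 le_rfl⟩ :=
    measurable_pi_apply _
  have hK : Measurable fun h : (_ : Finset.Iic n) → ℕ =>
      ∫⁻ l, f l ∂(p (h ⟨n, Finset.mem_Iic.2 le_rfl⟩)).toMeasure :=
    (Measurable.of_discrete (f := fun m : ℕ => ∫⁻ l, f l ∂(p m).toMeasure)).comp hcur
  let H : ((_ : Finset.Iic (n + 1)) → ℕ) → ℝ≥0∞ := fun h =>
    G (Preorder.frestrictLe₂ (π := fun _ => ℕ) n.le_succ h) *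
      f (h ⟨n + 1, Finset.mem_Iic.2 le_rfl⟩)
  have hH : Measurable H :=
    (hG.comp (Preorder.measurable_frestrictLe₂ _)).mul (hf.comp (measurable_pi_apply _))
  calc ∫⁻ ω, G (Preorder.frestrictLe n ω) * f (ω (n + 1)) ∂law p i
      = ∫⁻ h, H h ∂((law p i).map (Preorder.frestrictLe (n + 1))) := by
        rw [lintegral_map hH (Preorder.measurable_frestrictLe _)]; rfl
    _ = ∫⁻ h, H h ∂(Kernel.partialTraj (X := fun _ => ℕ) (histKernel p) 0 (n + 1) fun _ => i) := by
        rw [law, Kernel.traj_map_frestrictLe_apply]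
    _ = ∫⁻ h, G h * ∫⁻ l, f l ∂(p (h ⟨n, Finset.mem_Iic.2 le_rfl⟩)).toMeasure
          ∂(Kernel.partialTraj (X := fun _ => ℕ) (histKernel p) 0 n fun _ => i) := by
        rw [Kernel.partialTraj_succ_eq_comp (Nat.zero_le n), Kernel.lintegral_comp _ _ _ hH]
        refine lintegral_congr fun h => ?_
        rw [Kernel.partialTraj_succ_self, Kernel.lintegral_map _ (by fun_prop) _ hH,
          Kernel.lintegral_id_prod (by fun_prop),
          Kernel.lintegral_map _ (by fun_prop) _ (by fun_prop), ← lintegral_const_mul _ hf]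
        refine lintegral_congr fun l => ?_
        have e1 (z : (_ : Finset.Ioc n (n + 1)) → ℕ) : Preorder.frestrictLe₂ (π := fun _ => ℕ)
            n.le_succ (IicProdIoc (X := fun _ => ℕ) n (n + 1) (h, z)) = h :=
          congrFun (frestrictLe₂_comp_IicProdIoc (X := fun _ => ℕ) n.le_succ) (h, z)
        have e2 : IicProdIoc (X := fun _ => ℕ) n (n + 1)
            (h, MeasurableEquiv.piSingleton (X := fun _ => ℕ) n l)
            ⟨n + 1, Finset.mem_Iic.2 le_rfl⟩ = l := by
          simp [IicProdIoc_def, MeasurableEquiv.piSingleton]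
        simp only [H, e1, e2]
    _ = _ := by
        rw [← Kernel.traj_map_frestrictLe_apply]
        exact lintegral_map (hG.mul hK) (Preorder.measurable_frestrictLe _)

lemma law_ae_zero (p : ℕ → PMF ℕ) (i : ℕ) : ∀ᵐ ω ∂law p i, ω 0 = i := by
  have h : (law p i).map (Preorder.frestrictLe 0) = Measure.dirac (fun _ => i) := by
    rw [law, Kernel.traj_map_frestrictLe_apply, Kernel.partialTraj_self, Kernel.id_apply]
  have h2 : ∀ᵐ x ∂((law p i).map (Preorder.frestrictLe 0)),
      x ⟨0, Finset.mem_Iic.2 le_rfl⟩ = i := by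
    rw [h]
    have hm : Measurable fun x : (_ : Finset.Iic 0) → ℕ => x ⟨0, Finset.mem_Iic.2 le_rfl⟩ :=
      measurable_pi_apply _
    exact (ae_dirac_iff (hm (measurableSet_singleton i))).2 rfl
  exact ae_of_ae_map (Preorder.measurable_frestrictLe _).aemeasurable h2

/-- The iterates of `tabooOp p S` compute expectations on the event that the chain stays in `S`. -/
lemma lintegral_law_stays (p : ℕ → PMF ℕ) (S : Set ℕ) (i n : ℕ) (f : ℕ → ℝ≥0∞) :
    ∫⁻ ω, (stays S n).indicator 1 ω * f (ω n) ∂law p i = (tabooOp p S)^[n] f i := by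
  induction n generalizing f with
  | zero =>
    have : ∀ᵐ ω ∂law p i, (stays S 0).indicator 1 ω * f (ω 0) = f i := by
      filter_upwards [law_ae_zero p i] with ω hω
      have : ω ∈ stays S 0 := fun m h1 h2 => by omega
      simp [this, hω]
    rw [lintegral_congr_ae this]; simp
  | succ n ih =>
    rw [Function.iterate_succ_apply, ← ih]
    let A : Set ((_ : Finset.Iic n) → ℕ) := {h | ∀ m : Finset.Iic n, 1 ≤ m.1 → h m ∈ S}
    have hA : MeasurableSet A := by
      have : A = ⋂ m, ⋂ (_ : 1 ≤ m.1), (fun h : (_ : Finset.Iic n) → ℕ => h m) ⁻¹' S := by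
        ext ω; simp [A]
      rw [this]
      exact MeasurableSet.iInter fun m => MeasurableSet.iInter fun _ =>
        measurable_pi_apply m (.of_discrete)
    have hmem : ∀ ω : ℕ → ℕ, Preorder.frestrictLe (π := fun _ => ℕ) n ω ∈ A ↔ ω ∈ stays S n := by
      intro ω
      exact ⟨fun h m h1 h2 => h ⟨m, Finset.mem_Iic.2 h2⟩ h1,
        fun h m h1 => h m h1 (Finset.mem_Iic.1 m.2)⟩
    have key := lintegral_law_mul_succ p i n (G := A.indicator 1)
      (measurable_one.indicator hA) (S.indicator f)
    have e1 : ∀ ω : ℕ → ℕ, A.indicator (1 : ((_ : Finset.Iic n) → ℕ) → ℝ≥0∞)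
        (Preorder.frestrictLe (π := fun _ => ℕ) n ω) = (stays S n).indicator 1 ω := by
      intro ω
      by_cases h : ω ∈ stays S n
      · rw [Set.indicator_of_mem h, Set.indicator_of_mem ((hmem ω).2 h)]; rfl
      · rw [Set.indicator_of_notMem h, Set.indicator_of_notMem (mt (hmem ω).1 h)]
    simp only [e1] at key
    calc _ = ∫⁻ ω, (stays S n).indicator 1 ω * S.indicator f (ω (n + 1)) ∂law p i := by
          refine lintegral_congr fun ω => ?_
          have : ω ∈ stays S (n + 1) ↔ ω ∈ stays S n ∧ ω (n + 1) ∈ S := by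
            refine ⟨fun h => ⟨fun m h1 h2 => h m h1 (by omega), h _ (by omega) le_rfl⟩,
              fun h m h1 h2 => ?_⟩
            rcases Nat.lt_or_ge n m with h3 | h3
            · obtain rfl : m = n + 1 := by omega
              exact h.2
            · exact h.1 m h1 h3
          by_cases h1 : ω ∈ stays S n <;> by_cases h2 : ω (n + 1) ∈ S <;> simp [this, h1, h2]
      _ = _ := by
          rw [key]
          refine lintegral_congr fun ω => ?_
          rw [tabooOp, lintegral_indicator (.of_discrete)]

lemma law_stays (p : ℕ → PMF ℕ) (S : Set ℕ) (i n : ℕ) :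
    law p i (stays S n) = (tabooOp p S)^[n] 1 i := by
  rw [← lintegral_law_stays, ← lintegral_indicator_one (measurableSet_stays S n)]
  simp


/-! ### Basic properties of the killed transition operator -/

lemma lintegral_pmf (q : PMF ℕ) (f : ℕ → ℝ≥0∞) :
    ∫⁻ l, f l ∂q.toMeasure = ∑' l, q l * f l := by
  rw [lintegral_countable']
  refine tsum_congr fun l => ?_
  rw [PMF.toMeasure_apply_singleton q l (measurableSet_singleton l), mul_comm]

lemma tabooOp_mono (p : ℕ → PMF ℕ) (S : Set ℕ) : Monotone (tabooOp p S) :=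
  fun _ _ h _ => lintegral_mono h

lemma tabooOp_one_le (p : ℕ → PMF ℕ) (S : Set ℕ) : tabooOp p S 1 ≤ 1 := by
  intro i
  calc tabooOp p S 1 i ≤ ∫⁻ _, 1 ∂(p i).toMeasure := setLIntegral_le_lintegral _ _
    _ = 1 := by simp

lemma tabooOp_eq_lintegral {p : ℕ → PMF ℕ} {S : Set ℕ} {f : ℕ → ℝ≥0∞} (h : ∀ l ∉ S, f l = 0)
    (i : ℕ) : tabooOp p S f i = ∫⁻ l, f l ∂(p i).toMeasure := by
  rw [tabooOp, ← lintegral_indicator (.of_discrete), Set.indicator_eq_self.2]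
  intro l hl
  by_contra hS
  exact hl (h l hS)

lemma antitone_iterate_tabooOp (p : ℕ → PMF ℕ) (S : Set ℕ) :
    Antitone fun n => (tabooOp p S)^[n] 1 :=
  (tabooOp_mono p S).antitone_iterate_of_map_le (tabooOp_one_le p S)

/-- The probability of staying in `S` for all times `n ≥ 1` is invariant under `tabooOp p S`. -/
lemma tabooOp_iInf_iterate (p : ℕ → PMF ℕ) (S : Set ℕ) (i : ℕ) :
    tabooOp p S (fun l => ⨅ n, (tabooOp p S)^[n] 1 l) i = ⨅ n, (tabooOp p S)^[n] 1 i := by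
  have hanti := antitone_iterate_tabooOp p S
  rw [tabooOp, lintegral_iInf (fun _ => .of_discrete) hanti
    ((tabooOp_one_le p S i).trans_lt ENNReal.one_lt_top).ne]
  have h : ∀ n, ∫⁻ l in S, (tabooOp p S)^[n] 1 l ∂(p i).toMeasure = (tabooOp p S)^[n + 1] 1 i :=
    fun n => by rw [Function.iterate_succ_apply']; rfl
  simp only [h]
  exact le_antisymm (le_iInf fun n => (iInf_le _ n).trans (hanti n.le_succ i))
    (le_iInf fun n => iInf_le _ (n + 1))

/-! ### Maximum principles and recurrence -/

/-- A nonempty set of states that is closed under possible transitions contains every state of an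
irreducible chain. -/
lemma IsIrreducible.mem_of_closed {p : ℕ → PMF ℕ} (hirr : IsIrreducible p) {E : Set ℕ}
    (hE : ∀ i ∈ E, ∀ l, p i l ≠ 0 → l ∈ E) {i : ℕ} (hi : i ∈ E) (j : ℕ) : j ∈ E := by
  by_contra hj
  have hzero : ∀ n, ∀ i ∈ E, (tabooOp p Set.univ)^[n] (Pi.single j 1) i = 0 := by
    intro n
    induction n with
    | zero => exact fun i hi => Pi.single_eq_of_ne (by rintro rfl; exact hj hi) _
    | succ n ih =>
      intro i hi
      rw [Function.iterate_succ_apply', tabooOp_eq_lintegral (by simp), lintegral_pmf]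
      refine ENNReal.tsum_eq_zero.2 fun l => ?_
      by_cases hl : p i l = 0
      · simp [hl]
      · rw [ih l (hE i hi l hl), mul_zero]
  refine (hirr i j).ne' ?_
  rw [Set.ofPred_exists]
  refine measure_iUnion_null fun n => ?_
  have hm : MeasurableSet {ω : ℕ → ℕ | ω n = j} :=
    measurableSet_eq_fun (measurable_pi_apply n) measurable_const
  rw [← lintegral_indicator_one hm, ← hzero n i hi, ← lintegral_law_stays]
  refine lintegral_congr fun ω => ?_
  have : ω ∈ stays Set.univ n := fun _ _ _ => Set.mem_univ _
  by_cases h : ω n = j <;> simp [this, h, Set.indicator]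

/-- Strong maximum principle: if `f ≤ F` with equality at `i`, where `f` is subharmonic and `F` is
superharmonic at `i`, then equality holds at all successors of `i`. -/
lemma eq_of_touching {q : PMF ℕ} {f F : ℕ → ℝ≥0∞} (hle : f ≤ F) {i : ℕ} (heq : f i = F i)
    (hfin : F i ≠ ⊤) (hf : f i ≤ ∫⁻ l, f l ∂q.toMeasure) (hF : ∫⁻ l, F l ∂q.toMeasure ≤ F i)
    {l : ℕ} (hl : q l ≠ 0) : f l = F l := by
  have h := ae_eq_of_ae_le_of_lintegral_le (Filter.Eventually.of_forall hle)
    (((lintegral_mono hle).trans hF).trans_lt hfin.lt_top).ne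
    (Measurable.of_discrete).aemeasurable (hF.trans (heq ▸ hf))
  by_contra hne
  have h0 : q.toMeasure {l} = 0 := measure_mono_null (by simpa using hne) (ae_iff.1 h)
  rw [PMF.toMeasure_apply_singleton q l (measurableSet_singleton l)] at h0
  exact hl h0

/-- Maximum principle of Foster type: a bounded function `g` that vanishes at `j` and is harmonic
at the other states is zero, if the identity is superharmonic outside `{0, …, N - 1}`. -/
lemma IsIrreducible.eq_zero_of_harmonic {p : ℕ → PMF ℕ} (hirr : IsIrreducible p) {N : ℕ}
    (hid : ∀ i, N ≤ i → ∫⁻ l, (l : ℝ≥0∞) ∂(p i).toMeasure ≤ i) {g : ℕ → ℝ≥0∞} (hg1 : ∀ i, g i ≤ 1)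
    {j : ℕ} (hgj : g j = 0) (hg : ∀ i, i ≠ j → g i ≤ ∫⁻ l, g l ∂(p i).toMeasure) : g = 0 := by
  have hsub : ∀ i, g i ≤ ∫⁻ l, g l ∂(p i).toMeasure := by
    intro i
    rcases eq_or_ne i j with rfl | hi
    · simp [hgj]
    · exact hg i hi
  obtain ⟨a, -, ha⟩ := Finset.exists_max_image (Finset.range (N + 1)) g ⟨0, by simp⟩
  -- The tilt `ε * i` makes the maximum attained. If it exceeds `g a`, all maximum points are `≥ N`,
  -- so they form a closed set, which contains `j`.
  have htilt : ∀ ε : ℝ≥0∞, ε ≠ 0 → ε ≠ ⊤ → ∀ i, g i ≤ g a + ε * i := by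
    intro ε hε hεt
    by_contra! hcon
    obtain ⟨i₀, hi₀⟩ := hcon
    obtain ⟨K, hK⟩ : ∃ K : ℕ, 1 ≤ ε * K := by
      obtain ⟨K, hK⟩ := ENNReal.exists_nat_mul_gt hε ENNReal.one_ne_top
      exact ⟨K, by rw [mul_comm]; exact hK.le⟩
    obtain ⟨b, -, hb⟩ := Finset.exists_max_image (Finset.range (K + 1)) (fun i => g i - ε * i)
      ⟨0, by simp⟩
    have hball : ∀ i : ℕ, g i - ε * i ≤ g b - ε * b := by
      intro i
      rcases le_total K i with h | h
      · rw [tsub_eq_zero_of_le]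
        · exact zero_le
        · calc g i ≤ 1 := hg1 i
            _ ≤ ε * K := hK
            _ ≤ ε * i := by gcongr
      · exact hb i (Finset.mem_range.2 (by omega))
    set s := g b - ε * b with hs
    have hsa : g a < s := (lt_tsub_iff_right.2 hi₀).trans_le (hball i₀)
    have hs0 : 0 < s := (zero_le).trans_lt hsa
    have hst : s ≠ ⊤ := ((tsub_le_self.trans (hg1 b)).trans_lt ENNReal.one_lt_top).ne
    have hgF : ∀ l : ℕ, g l ≤ s + ε * l := fun l => tsub_le_iff_right.1 (hball l)
    have hmem : j ∈ {l : ℕ | g l = s + ε * l} := by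
      refine hirr.mem_of_closed (i := b) ?_ ?_ j
      · intro i hi l hl
        have hNi : N ≤ i := by
          by_contra! h
          have h1 : g i ≤ g a := ha i (Finset.mem_range.2 (by omega))
          have h2 : s ≤ g i := by rw [show g i = s + ε * i from hi]; exact le_self_add
          exact absurd (h2.trans h1) (not_le.2 hsa)
        refine eq_of_touching (F := fun l : ℕ => s + ε * l) hgF hi
          (ENNReal.add_ne_top.2 ⟨hst, ENNReal.mul_ne_top hεt (ENNReal.natCast_ne_top i)⟩)
          (hsub i) ?_ hl
        rw [lintegral_add_left measurable_const, lintegral_const_mul _ (.of_discrete)]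
        simp only [lintegral_const, measure_univ, mul_one]
        gcongr
        exact hid i hNi
      · exact (tsub_add_cancel_of_le (tsub_pos_iff_lt.1 hs0).le).symm
    have : g j = s + ε * j := hmem
    rw [hgj] at this
    exact hs0.ne' (add_eq_zero.1 this.symm).1
  have hmax : ∀ i, g i ≤ g a := by
    intro i
    refine ENNReal.le_of_forall_pos_le_add fun δ hδ _ => ?_
    have hi1 : ((i : ℝ≥0∞) + 1) ≠ 0 := by positivity
    have hi2 : ((i : ℝ≥0∞) + 1) ≠ ⊤ := by simp
    refine (htilt (δ / (i + 1)) ?_ ?_ i).trans ?_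
    · exact (ENNReal.div_pos (by exact_mod_cast hδ.ne') hi2).ne'
    · exact ENNReal.div_ne_top (by simp) hi1
    · gcongr
      calc (δ : ℝ≥0∞) / (i + 1) * i ≤ δ / (i + 1) * (i + 1) := by gcongr; exact le_self_add
        _ = δ := ENNReal.div_mul_cancel hi1 hi2
  have hconst : ∀ l, g l = g a := by
    refine fun l => hirr.mem_of_closed (E := {l | g l = g a}) (i := a) ?_ rfl l
    intro i hi l hl
    exact eq_of_touching (F := fun _ => g a) hmax hi
      ((hg1 a).trans_lt ENNReal.one_lt_top).ne (hsub i) (by simp) hl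
  funext l
  rw [hconst l, ← hconst j, hgj]; rfl

/-- The chain started anywhere hits `j` almost surely. -/
lemma IsIrreducible.iInf_iterate_eq_zero {p : ℕ → PMF ℕ} (hirr : IsIrreducible p) {N : ℕ}
    (hid : ∀ i, N ≤ i → ∫⁻ l, (l : ℝ≥0∞) ∂(p i).toMeasure ≤ i) (j i : ℕ) :
    ⨅ n, (tabooOp p {j}ᶜ)^[n] 1 i = 0 := by
  set h : ℕ → ℝ≥0∞ := fun l => ⨅ n, (tabooOp p {j}ᶜ)^[n] 1 l with hh
  let g : ℕ → ℝ≥0∞ := Set.indicator {j}ᶜ h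
  have hQ : ∀ i, h i = ∫⁻ l, g l ∂(p i).toMeasure := by
    intro i
    rw [lintegral_indicator (.of_discrete)]
    exact (tabooOp_iInf_iterate p {j}ᶜ i).symm
  have hg : g = 0 := by
    refine hirr.eq_zero_of_harmonic hid (j := j) (fun i => ?_) (by simp [g]) fun i hi => ?_
    · exact (Set.indicator_le_self _ _ i).trans (iInf_le _ 0)
    · rw [← hQ]; exact Set.indicator_le_self _ _ i
  change h i = 0
  rw [hQ, hg]; simp


/-! ### The drift condition -/

/-- At a state of zero mean drift the identity is harmonic. The downward part of the drift is at
most `i`, hence finite, so the two parts can be rearranged in `ℝ≥0∞`. -/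
lemma lintegral_id_eq_of_meanDrift_eq_zero {p : ℕ → PMF ℕ} {i : ℕ} (h : meanDrift p i = 0) :
    ∫⁻ l, (l : ℝ≥0∞) ∂(p i).toMeasure = i := by
  have hdown : ∫⁻ l, ((i - l : ℕ) : ℝ≥0∞) ∂(p i).toMeasure ≠ ⊤ := by
    refine ne_top_of_le_ne_top (ENNReal.natCast_ne_top i) ?_
    calc ∫⁻ l, ((i - l : ℕ) : ℝ≥0∞) ∂(p i).toMeasure ≤ ∫⁻ _, (i : ℝ≥0∞) ∂(p i).toMeasure :=
          lintegral_mono fun l => Nat.cast_le.2 (Nat.sub_le i l)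
      _ = i := by simp
  have heq : ∫⁻ l, ((l - i : ℕ) : ℝ≥0∞) ∂(p i).toMeasure =
      ∫⁻ l, ((i - l : ℕ) : ℝ≥0∞) ∂(p i).toMeasure := by
    rw [meanDrift, ← lintegral_pmf, ← lintegral_pmf] at h
    generalize ∫⁻ l, ((l - i : ℕ) : ℝ≥0∞) ∂(p i).toMeasure = A at h
    generalize ∫⁻ l, ((i - l : ℕ) : ℝ≥0∞) ∂(p i).toMeasure = B at h hdown
    have hB : (B : EReal) ≠ ⊤ := mt EReal.coe_ennreal_eq_top_iff.1 hdown
    exact EReal.coe_ennreal_injective (le_antisymm (EReal.sub_nonpos.1 h.le)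
      ((EReal.sub_nonneg (.inr hB) (.inr (EReal.coe_ennreal_ne_bot B))).1 h.ge))
  have hsum : ∫⁻ l, (l : ℝ≥0∞) ∂(p i).toMeasure + ∫⁻ l, ((i - l : ℕ) : ℝ≥0∞) ∂(p i).toMeasure =
      i + ∫⁻ l, ((l - i : ℕ) : ℝ≥0∞) ∂(p i).toMeasure := by
    rw [← lintegral_add_left (.of_discrete)]
    calc _ = ∫⁻ l, ((i : ℝ≥0∞) + ((l - i : ℕ) : ℝ≥0∞)) ∂(p i).toMeasure := by
          refine lintegral_congr fun l => ?_
          rw [← Nat.cast_add, ← Nat.cast_add, show l + (i - l) = i + (l - i) by omega]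
      _ = _ := by rw [lintegral_add_left measurable_const]; simp
  rw [heq] at hsum
  exact (ENNReal.add_left_inj hdown).1 hsum

/-! ### Expected hitting times -/

/-- The expected time `∑ n, ℙ(X 1, …, X n ∈ S)` until the chain leaves `S`, as a function of the
initial state; time `0` is not taken into account. -/
noncomputable def exitTime (p : ℕ → PMF ℕ) (S : Set ℕ) (i : ℕ) : ℝ≥0∞ :=
  ∑' n, (tabooOp p S)^[n] 1 i

/-- Iterating the killed operator on the expected exit time gives the tails of its series. -/
lemma iterate_tabooOp_exitTime (p : ℕ → PMF ℕ) (S : Set ℕ) (n i : ℕ) :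
    (tabooOp p S)^[n] (exitTime p S) i = ∑' m, (tabooOp p S)^[m + n] 1 i := by
  induction n generalizing i with
  | zero => rfl
  | succ n ih =>
    rw [Function.iterate_succ_apply', tabooOp, funext ih, lintegral_tsum fun _ => .of_discrete]
    refine tsum_congr fun m => ?_
    rw [← add_assoc, Function.iterate_succ_apply']; rfl

lemma exitTime_eq (p : ℕ → PMF ℕ) (S : Set ℕ) (i : ℕ) :
    exitTime p S i = 1 + tabooOp p S (exitTime p S) i := by
  rw [exitTime, tsum_eq_zero_add' ENNReal.summable]
  exact congrArg _ (iterate_tabooOp_exitTime p S 1 i).symm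

/-- In an irreducible chain, the expected time to hit `j` is finite from everywhere as soon as the
expected return time to `j` is finite. -/
lemma IsIrreducible.exitTime_ne_top {p : ℕ → PMF ℕ} (hirr : IsIrreducible p) {j : ℕ}
    (hj : exitTime p {j}ᶜ j ≠ ⊤) (i : ℕ) : exitTime p {j}ᶜ i ≠ ⊤ := by
  refine hirr.mem_of_closed (E := {i | exitTime p {j}ᶜ i ≠ ⊤}) ?_ hj i
  intro i hi l hl
  rcases eq_or_ne l j with rfl | hlj
  · exact hj
  have h1 : tabooOp p {j}ᶜ (exitTime p {j}ᶜ) i ≠ ⊤ := by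
    intro h
    exact hi (by rw [exitTime_eq, h, add_top])
  have h2 : p i l * exitTime p {j}ᶜ l ≤ tabooOp p {j}ᶜ (exitTime p {j}ᶜ) i := by
    rw [tabooOp, ← lintegral_indicator (.of_discrete), lintegral_pmf]
    refine le_trans (le_of_eq ?_) (ENNReal.le_tsum l)
    rw [Set.indicator_of_mem (show l ∈ ({j}ᶜ : Set ℕ) from hlj)]
  intro h3
  rw [h3, ENNReal.mul_top hl] at h2
  exact h1 (top_le_iff.1 h2)

/-- If the chain jumps down by at most `k`, it needs more than `n` steps to reach `j` from above
`j + k * n`. -/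
lemma iterate_tabooOp_one_eq_one {p : ℕ → PMF ℕ} {k : ℕ} (hk : ∀ i l, l + k < i → p i l = 0)
    {j : ℕ} (n : ℕ) {x : ℕ} (hx : j + k * n < x) : (tabooOp p {j}ᶜ)^[n] 1 x = 1 := by
  induction n generalizing x with
  | zero => rfl
  | succ n ih =>
    rw [Function.iterate_succ_apply', tabooOp, ← lintegral_indicator (.of_discrete), lintegral_pmf]
    rw [← (p x).tsum_coe]
    refine tsum_congr fun l => ?_
    by_cases hl : l + k < x
    · rw [hk x l hl, zero_mul]
    · rw [mul_add] at hx
      have hjl : j + k * n < l := by omega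
      have hne : l ∈ ({j}ᶜ : Set ℕ) := by
        rintro rfl
        exact absurd hjl (not_lt.2 (Nat.le_add_right _ _))
      rw [Set.indicator_of_mem hne, ih hjl, mul_one]

/-- From above `j`, a chain that jumps down by at most `k` needs at least `(x - j) / k` steps to
reach `j`. -/
lemma sub_le_mul_exitTime {p : ℕ → PMF ℕ} {k : ℕ} (hk : ∀ i l, l + k < i → p i l = 0)
    (hk0 : 0 < k) (j x : ℕ) : ((x - j : ℕ) : ℝ≥0∞) ≤ k * exitTime p {j}ᶜ x := by
  -- `r = ⌈(x - j) / k⌉` is the number of `n` with `j + k * n < x`.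
  set r := (x - j + (k - 1)) / k with hr
  have h1 : x - j ≤ k * r := by
    have := Nat.div_add_mod (x - j + (k - 1)) k
    have := Nat.mod_lt (x - j + (k - 1)) hk0
    rw [← hr] at *
    omega
  have h2 : (r : ℝ≥0∞) ≤ exitTime p {j}ᶜ x := by
    calc (r : ℝ≥0∞) = ∑ n ∈ Finset.range r, (tabooOp p {j}ᶜ)^[n] 1 x := by
          rw [Finset.sum_congr rfl (g := fun _ => (1 : ℝ≥0∞))]
          · simp
          · intro n hn
            refine iterate_tabooOp_one_eq_one hk n ?_
            have h3 : (n + 1) * k ≤ x - j + (k - 1) :=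
              (Nat.le_div_iff_mul_le hk0).1 (Finset.mem_range.1 hn)
            rw [add_mul, one_mul, mul_comm] at h3
            omega
      _ ≤ _ := ENNReal.sum_le_tsum _
  calc ((x - j : ℕ) : ℝ≥0∞) ≤ ((k * r : ℕ) : ℝ≥0∞) := Nat.cast_le.2 h1
    _ = k * r := by push_cast; rfl
    _ ≤ _ := by gcongr

lemma iterate_tabooOp_const_mul (p : ℕ → PMF ℕ) (S : Set ℕ) (c : ℝ≥0∞) (f : ℕ → ℝ≥0∞) (n i : ℕ) :
    (tabooOp p S)^[n] (fun l => c * f l) i = c * (tabooOp p S)^[n] f i := by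
  induction n generalizing i with
  | zero => rfl
  | succ n ih =>
    rw [Function.iterate_succ_apply', Function.iterate_succ_apply', tabooOp, funext ih,
      lintegral_const_mul _ (.of_discrete)]
    rfl

/-- The expected return time to `j` is infinite. -/
lemma IsIrreducible.exitTime_eq_top {p : ℕ → PMF ℕ} (hirr : IsIrreducible p) {k : ℕ}
    (hk : ∀ i l, l + k < i → p i l = 0) (hk0 : 0 < k) {N : ℕ}
    (hid : ∀ i, N ≤ i → i ≤ ∫⁻ l, (l : ℝ≥0∞) ∂(p i).toMeasure) (j : ℕ) :
    exitTime p {j}ᶜ j = ⊤ := by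
  by_contra hj
  set M := max N j with hM
  let u : ℕ → ℝ≥0∞ := fun x => ((x - M : ℕ) : ℝ≥0∞)
  -- `u` vanishes at `j`, so it remains subharmonic for the chain killed at `j`.
  have hsub : u ≤ tabooOp p {j}ᶜ u := by
    intro x
    rw [tabooOp_eq_lintegral]
    swap
    · intro l hl
      have : l = j := by simpa using hl
      exact Nat.cast_eq_zero.2 (by omega)
    rcases le_total x M with hx | hx
    · have : u x = 0 := Nat.cast_eq_zero.2 (Nat.sub_eq_zero_of_le hx)
      rw [this]
      exact zero_le
    · have h1 : (x : ℝ≥0∞) ≤ ∫⁻ l, u l ∂(p x).toMeasure + M := by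
        calc (x : ℝ≥0∞) ≤ ∫⁻ l, (l : ℝ≥0∞) ∂(p x).toMeasure := hid x ((le_max_left _ _).trans hx)
          _ ≤ ∫⁻ l, (u l + M) ∂(p x).toMeasure := by
              refine lintegral_mono fun l => ?_
              simp only [u]
              rw [← Nat.cast_add]
              exact Nat.cast_le.2 (by omega)
          _ = _ := by rw [lintegral_add_right _ measurable_const]; simp
      have : u x = (x : ℝ≥0∞) - M := ENNReal.natCast_sub _ _
      rw [this]
      exact tsub_le_iff_right.2 h1
  have hiter : ∀ n, u ≤ (tabooOp p {j}ᶜ)^[n] u := fun n =>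
    (tabooOp_mono p {j}ᶜ).monotone_iterate_of_le_map hsub (Nat.zero_le n)
  have huw : u ≤ fun x => k * exitTime p {j}ᶜ x := fun x =>
    (Nat.cast_le.2 (by omega)).trans (sub_le_mul_exitTime hk hk0 j x)
  -- Hence `1 = u (M + 1)` is at most `k` times the tail of the series for the
  -- expected hitting time.
  have hbound : ∀ n, 1 ≤ k * ∑' m, (tabooOp p {j}ᶜ)^[m + n] 1 (M + 1) := by
    intro n
    rw [← iterate_tabooOp_exitTime, ← iterate_tabooOp_const_mul]
    refine le_trans ?_ ((hiter n).trans ((tabooOp_mono p {j}ᶜ).iterate n huw) (M + 1))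
    simp [u]
  have htail := ENNReal.Tendsto.const_mul (a := (k : ℝ≥0∞))
    (ENNReal.tendsto_sum_nat_add _ (hirr.exitTime_ne_top hj (M + 1)))
    (Or.inr (ENNReal.natCast_ne_top k))
  rw [mul_zero] at htail
  exact absurd (ge_of_tendsto' htail hbound) (by simp)

/-! ### Return times of trajectories -/

lemma returnTime_le {i m : ℕ} {ω : ℕ → ℕ} (hm : 1 ≤ m) (h : ω m = i) : returnTime i ω ≤ m :=
  iInf₂_le m ⟨hm, h⟩

lemma exists_eq_of_returnTime_lt_top {i : ℕ} {ω : ℕ → ℕ} (h : returnTime i ω < ⊤) :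
    ∃ m : ℕ, 1 ≤ m ∧ ω m = i ∧ returnTime i ω = m := by
  have hne : ∃ m : ℕ, 1 ≤ m ∧ ω m = i := by
    by_contra! hcon
    refine h.ne ?_
    simp only [returnTime, iInf_eq_top]
    exact fun m hm => absurd hm.2 (hcon m hm.1)
  classical
  refine ⟨Nat.find hne, (Nat.find_spec hne).1, (Nat.find_spec hne).2, le_antisymm
    (returnTime_le (Nat.find_spec hne).1 (Nat.find_spec hne).2) ?_⟩
  exact le_iInf₂ fun m hm => Nat.cast_le.2 (Nat.find_min' hne hm)

lemma setOf_returnTime_lt_top (i : ℕ) :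
    {ω | returnTime i ω < ⊤} = (⋂ n, stays {i}ᶜ n)ᶜ := by
  ext ω
  simp only [Set.mem_ofPred_eq, Set.mem_compl_iff, Set.mem_iInter, not_forall]
  constructor
  · intro h
    obtain ⟨m, hm, hω, -⟩ := exists_eq_of_returnTime_lt_top h
    exact ⟨m, fun hs => hs m hm le_rfl hω⟩
  · rintro ⟨n, hn⟩
    simp only [stays, Set.mem_ofPred_eq, not_forall, Set.mem_compl_iff, Set.mem_singleton_iff,
      not_not] at hn
    obtain ⟨m, hm, -, hω⟩ := hn
    exact (returnTime_le hm hω).trans_lt (WithTop.coe_lt_top m)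

lemma tsum_indicator_stays_le_returnTime (i : ℕ) (ω : ℕ → ℕ) :
    ∑' n, (stays {i}ᶜ n).indicator (1 : (ℕ → ℕ) → ℝ≥0∞) ω ≤ (returnTime i ω : ℝ≥0∞) := by
  rcases eq_or_ne (returnTime i ω) ⊤ with h | h
  · simp [h]
  obtain ⟨m, hm, hω, heq⟩ := exists_eq_of_returnTime_lt_top h.lt_top
  have hzero : ∀ n ∉ Finset.range m, (stays {i}ᶜ n).indicator (1 : (ℕ → ℕ) → ℝ≥0∞) ω = 0 := by
    intro n hn
    refine Set.indicator_of_notMem (fun hs => ?_) _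
    exact hs m hm (by simpa using hn) hω
  rw [tsum_eq_sum hzero, heq]
  calc ∑ n ∈ Finset.range m, (stays {i}ᶜ n).indicator (1 : (ℕ → ℕ) → ℝ≥0∞) ω
      ≤ ∑ n ∈ Finset.range m, 1 :=
        Finset.sum_le_sum fun n _ => Set.indicator_le_self' (by simp) _
    _ = _ := by simp

/-- Tail-sum formula for the expected return time; equality holds, but this half suffices. -/
lemma exitTime_le_lintegral_returnTime (p : ℕ → PMF ℕ) (i : ℕ) :
    exitTime p {i}ᶜ i ≤ ∫⁻ ω, (returnTime i ω : ℝ≥0∞) ∂law p i := by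
  calc exitTime p {i}ᶜ i = ∫⁻ ω, ∑' n, (stays {i}ᶜ n).indicator 1 ω ∂law p i := by
        rw [lintegral_tsum fun n =>
          (measurable_one.indicator (measurableSet_stays _ n)).aemeasurable]
        refine tsum_congr fun n => ?_
        rw [lintegral_indicator_one (measurableSet_stays _ n), law_stays]
    _ ≤ _ := lintegral_mono (tsum_indicator_stays_le_returnTime i)

end MarkovChainNat

theorem lemma3p5 (p : ℕ → PMF ℕ)
    (hirr : MarkovChainNat.IsIrreducible p)
    (hdown : MarkovChainNat.IsDownwardUniformlyBounded p)
    (hfin : ∀ i : ℕ, MarkovChainNat.meanDrift p i < ⊤)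
    (hzero : ∃ N : ℕ, ∀ i : ℕ, N ≤ i → MarkovChainNat.meanDrift p i = 0) :
    MarkovChainNat.IsNullRecurrent p := by
  obtain ⟨N, hN⟩ := hzero
  obtain ⟨k, hk⟩ := hdown
  have hid := fun i hi => MarkovChainNat.lintegral_id_eq_of_meanDrift_eq_zero (hN i hi)
  refine fun i => ⟨?_, ?_⟩
  · rw [MarkovChainNat.IsRecurrentState, MarkovChainNat.setOf_returnTime_lt_top,
      prob_compl_eq_one_iff (MeasurableSet.iInter fun n => MarkovChainNat.measurableSet_stays _ n),
      ← nonpos_iff_eq_zero,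
      ← hirr.iInf_iterate_eq_zero (fun i hi => (hid i hi).le) i i]
    refine le_iInf fun n => ?_
    rw [← MarkovChainNat.law_stays]
    exact measure_mono (Set.iInter_subset _ n)
  · refine top_le_iff.1 (le_trans (ge_of_eq ?_)
      (MarkovChainNat.exitTime_le_lintegral_returnTime p i))
    -- `k + 1` replaces `k`, which may be zero.
    exact hirr.exitTime_eq_top (k := k + 1) (fun i l hl => hk i l (by omega)) k.succ_pos
      (fun i hi => (hid i hi).ge) i
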